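/- Let $N=\{1,\dots,n\}$, $n\ge 1$, be agents with real weights $w_i>0$, $W=\sum_i w_i$, $w_{\min}=\min_i w_i$, and let $M$ be a set of $m$ items. Valuations are binary additive: $v_i(A)=\sum_{o\in A}v_i(\{o\})$ with $v_i(\{o\})\in\{0,1\}$. An allocation $X$ assigns disjoint bundles $X_i\subseteq M$ to the agents; the unassigned items are held by a dummy agent $i_0$. A pair $(X,p)$ with $p\in\mathbb{R}_{\ge 0}^N$ is weighted envy-free (WEF) if $\frac{v_i(X_i)+p_i}{w_i}\ge\frac{v_i(X_j)+p_j}{w_j}$ for all $i,j\in N$; $X$ is WEF-able if such a $p$ exists; $X$ is non-redundant if $v_i(X_i)=|X_i|$ for all $i\in N$. In the weighted envy-graph of $X$ the edge $(i,j)$ has cost $\frac{v_i(X_j)}{w_j}-\frac{v_i(X_i)}{w_i}$; $\ell_i(X)$ is the maximum cost of a (simple, possibly one-vertex) path starting at $i$, and the subsidy of agent $i$ is $p^*_i(X)=w_i\,\ell_i(X)$. A transfer path from $i_1$ is a sequence $(i_1,o_1),\dots,(i_k,o_k)$, $k\ge 1$, of distinct agents and of items with $v_{i_j}(\{o_j\})=1$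 for all $j$, $o_j\in X_{i_{j+1}}$ for $j<k$, and $o_k$ unassigned; transferring along it gives $o_j$ to $i_j$ for every $j$. Algorithm (weighted General Yankee Swap). Start with all items unassigned and $R=N$. While $R\ne\emptyset$: remove from $R$ all agents without a transfer path starting from them; if $R$ is still non-empty, choose an arbitrary $u\in R$ maximizing $\frac{w_u}{v_u(X_u)+1}$ and an arbitrary transfer path from $u$, and transfer the items along it. Return $X$. Theorem. For every such instance, every execution of the algorithm can be continued until $R=\emptyset$ and stops after at most $m+n$ iterations, and every allocation $X$ that it can output has the following properties. 1. $X$ is non-redundant, and an item is unassigned in $X$ if and only if no agent values it. 2. For $Y=X$, and for every allocation $Y$ obtained from $X$ by handing some or all of its unassigned items to agents (in particular for every complete such $Y$): $Y$ is WEF-able; $p^*(Y)$ is non-negative, $(Y,p^*(Y))$ is WEF, and $p^*(Y)\le p$ componentwise for every $p\ge 0$ such that $(Y,p)$ is WEF; $p^*_i(Y)\le\frac{w_i}{w_{\min}}$ for every $i\in N$; and $\sum_{i\in N}p^*_i(Y)\le\frac{W}{w_{\min}}-1$. Moreover, the algorithm runs in polynomial time: there are a program and a polynomial $q$ such that on every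 such instance the program halts after at most $q(n+m)$ elementary steps with an allocation that is an output of some execution of the algorithm. The machine model is a random access machine on natural numbers (with addition, truncated subtraction, comparison and arrays) that, at unit cost per operation, may also read entries $v_i(\{o\})$ and weights $w_i$ and compare real arithmetic expressions in them and in its natural numbers. -/

import Mathlib

/-! ## Instances, allocations, weighted envy-freeness -/

namespace WeightedYankee

/-- `n` agents with positive entitlements `w`, `m` items, and set-function valuations `v`. -/
structure Instance (n m : ℕ) where
  v : Fin n → Finset (Fin m) → ℝ
  w : Fin n → ℝ
  w_pos : ∀ i, 0 < w i

/-- An allocation, given by the owner of each item; `none` is the dummy agent, who holds the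
unassigned items. -/
abbrev Alloc (n m : ℕ) := Fin m → Option (Fin n)

/-- The bundle of agent `i`. -/
def Alloc.bundle {n m : ℕ} (X : Alloc n m) (i : Fin n) : Finset (Fin m) :=
  Finset.univ.filter (fun o => X o = some i)

/-- `Y` arises from `X` by handing some (possibly none, possibly all) of the unassigned items of
`X` to agents. -/
def Alloc.Extends {n m : ℕ} (Y X : Alloc n m) : Prop :=
  ∀ o i, X o = some i → Y o = some i

namespace Instance

variable {n m : ℕ} (I : Instance n m)

/-- Additive valuations in which every single item has value `0` or `1`. -/
def BinaryAdditive : Prop :=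
  ∀ i, (∀ A : Finset (Fin m), I.v i A = ∑ o ∈ A, I.v i {o}) ∧
    ∀ o, I.v i {o} = 0 ∨ I.v i {o} = 1

/-- The smallest entitlement (a minimum as soon as there is an agent). -/
noncomputable def wmin : ℝ := ⨅ i, I.w i

/-- The total entitlement. -/
noncomputable def W : ℝ := ∑ i, I.w i

/-- The outcome `(X, p)` is weighted envy-free. -/
def WEF (X : Alloc n m) (p : Fin n → ℝ) : Prop :=
  ∀ i j, (I.v i (X.bundle j) + p j) / I.w j ≤ (I.v i (X.bundle i) + p i) / I.w i

/-- The subsidy vectors (nonnegative payments) that make `X` weighted envy-free. -/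
def wefSubsidies (X : Alloc n m) : Set (Fin n → ℝ) :=
  {p | (∀ i, 0 ≤ p i) ∧ I.WEF X p}

/-- `X` is weighted envy-freeable. -/
def WEFable (X : Alloc n m) : Prop := ∃ p, p ∈ I.wefSubsidies X

/-- Every agent values each item of her bundle: `v_i(X_i) = |X_i|`. -/
def NonRedundant (X : Alloc n m) : Prop :=
  ∀ i, I.v i (X.bundle i) = ((X.bundle i).card : ℝ)

/-- Cost of the edge `(i, j)` of the weighted envy-graph. -/
noncomputable def edgeCost (X : Alloc n m) (i j : Fin n) : ℝ :=
  I.v i (X.bundle j) / I.w j - I.v i (X.bundle i) / I.w i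

/-- Cost of a path of the weighted envy-graph, given as its list of vertices. -/
noncomputable def pathCost (X : Alloc n m) : List (Fin n) → ℝ
  | [] => 0
  | [_] => 0
  | i :: j :: P => I.edgeCost X i j + pathCost X (j :: P)

/-- The maximum cost of a path starting at `i` in the weighted envy-graph (a maximum over a finite
set, which contains the cost `0` of the one-vertex path). -/
noncomputable def maxPathCost (X : Alloc n m) (i : Fin n) : ℝ :=
  sSup {c | ∃ P : List (Fin n), P.Nodup ∧ P.head? = some i ∧ c = I.pathCost X P}

/-- The subsidy `p*_i = w_i ℓ_i(X)` required by agent `i` under `X`. -/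
noncomputable def subsidy (X : Alloc n m) (i : Fin n) : ℝ := I.w i * I.maxPathCost X i

/-! ## The weighted sequence protocol (weighted General Yankee Swap) -/

/-- `TransferPath X i P`: the list `P = [(i₁, o₁), …, (i_k, o_k)]` is a transfer path from `i = i₁`
to the dummy agent: the agents are distinct, each `i_j` values `o_j`, which belongs to `i_{j+1}`
for `j < k` and to the dummy agent for `j = k`. -/
inductive TransferPath (X : Alloc n m) : Fin n → List (Fin n × Fin m) → Prop
  | last {i : Fin n} {o : Fin m} : 0 < I.v i {o} → X o = none → TransferPath X i [(i, o)]
  | step {i j : Fin n} {o : Fin m} {P : List (Fin n × Fin m)} :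
      0 < I.v i {o} → X o = some j → i ∉ P.map Prod.fst → TransferPath X j P →
      TransferPath X i ((i, o) :: P)

/-- Transfer along `P`: every agent of the path receives the item she is paired with. -/
def transfer (X : Alloc n m) (P : List (Fin n × Fin m)) : Alloc n m :=
  P.foldr (fun q Y => Function.update Y q.2 (some q.1)) X

/-- The agents of `R` that have a transfer path under `X`. -/
def remaining (X : Alloc n m) (R : Set (Fin n)) : Set (Fin n) :=
  {i | i ∈ R ∧ ∃ P, I.TransferPath X i P}

/-- The gain function. -/
noncomputable def gain (X : Alloc n m) (i : Fin n) : ℝ := I.w i / (I.v i (X.bundle i) + 1)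

/-- One iteration of the while loop, from the allocation and the set of agents in the game to
their new values. First the agents without a transfer path are removed. If nobody remains, nothing
is transferred; otherwise an arbitrary agent of maximum gain among the remaining ones obtains an
item along an arbitrary transfer path. -/
inductive Iteration : Alloc n m × Set (Fin n) → Alloc n m × Set (Fin n) → Prop
  | finish {X : Alloc n m} {R : Set (Fin n)} :
      R.Nonempty → I.remaining X R = ∅ → Iteration (X, R) (X, ∅)
  | assign {X : Alloc n m} {R : Set (Fin n)} {u : Fin n} {P : List (Fin n × Fin m)} :
      R.Nonempty → u ∈ I.remaining X R → (∀ i ∈ I.remaining X R, I.gain X i ≤ I.gain X u) →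
      I.TransferPath X u P → Iteration (X, R) (transfer X P, I.remaining X R)

/-- `Run t s`: some execution is in state `s` after `t` iterations. At the start all items are
unassigned and all agents are in the game. -/
inductive Run : ℕ → Alloc n m × Set (Fin n) → Prop
  | init : Run 0 (fun _ => none, Set.univ)
  | next {t : ℕ} {s s' : Alloc n m × Set (Fin n)} : Run t s → I.Iteration s s' → Run (t + 1) s'

/-- Some execution stops with the allocation `X`: nobody is left in the game. -/
def IsOutput (X : Alloc n m) : Prop := ∃ t, I.Run t (X, ∅)

end Instance

/-! ## A random access machine with step count

Programs are structured. The memory consists of natural-number registers and of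
natural-number arrays, each addressed by a constant of the program. The naturals are
only added and subtracted, so no large number arises within few steps. The input is read by
expressions for a single entry `v_i({o})` of the valuation matrix and for a single weight `w_i`;
real arithmetic occurs only inside a comparison, and no real number is ever stored. The cost of an
expression is its number of nodes. -/

/-- Memory: registers and arrays. -/
structure Mem where
  reg : ℕ → ℕ
  arr : ℕ → ℕ → ℕ

/-- Expressions for natural numbers. -/
inductive NExpr
  | const (c : ℕ)
  | reg (x : ℕ)
  | get (a : ℕ) (k : NExpr)
  | plus (e f : NExpr)
  | minus (e f : NExpr)

/-- Expressions for real numbers. -/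
inductive RExpr
  | ofNat (e : NExpr)
  | value (i o : NExpr)
  | weight (i : NExpr)
  | plus (e f : RExpr)
  | minus (e f : RExpr)
  | times (e f : RExpr)
  | quot (e f : RExpr)

/-- Tests. -/
inductive Test
  | nle (e f : NExpr)
  | rle (e f : RExpr)
  | neg (b : Test)
  | conj (b c : Test)

/-- Programs. -/
inductive Prog
  | skip
  | set (x : ℕ) (e : NExpr)
  | put (a : ℕ) (k e : NExpr)
  | seq (c d : Prog)
  | ite (b : Test) (c d : Prog)
  | loop (b : Test) (c : Prog)

def NExpr.cost : NExpr → ℕ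
  | const _ => 1
  | reg _ => 1
  | get _ k => k.cost + 1
  | plus e f => e.cost + f.cost + 1
  | minus e f => e.cost + f.cost + 1

def RExpr.cost : RExpr → ℕ
  | ofNat e => e.cost + 1
  | value i o => i.cost + o.cost + 1
  | weight i => i.cost + 1
  | plus e f => e.cost + f.cost + 1
  | minus e f => e.cost + f.cost + 1
  | times e f => e.cost + f.cost + 1
  | quot e f => e.cost + f.cost + 1

def Test.cost : Test → ℕ
  | nle e f => e.cost + f.cost + 1
  | rle e f => e.cost + f.cost + 1
  | neg b => b.cost + 1
  | conj b c => b.cost + c.cost + 1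

def NExpr.eval (s : Mem) : NExpr → ℕ
  | const c => c
  | reg x => s.reg x
  | get a k => s.arr a (k.eval s)
  | plus e f => e.eval s + f.eval s
  | minus e f => e.eval s - f.eval s

/-- Reading the input out of range gives `0`. -/
noncomputable def RExpr.eval {n m : ℕ} (I : Instance n m) (s : Mem) : RExpr → ℝ
  | ofNat e => (e.eval s : ℝ)
  | value i o =>
      if hi : i.eval s < n then
        if ho : o.eval s < m then I.v ⟨i.eval s, hi⟩ {⟨o.eval s, ho⟩} else 0
      else 0
  | weight i => if hi : i.eval s < n then I.w ⟨i.eval s, hi⟩ else 0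
  | plus e f => e.eval I s + f.eval I s
  | minus e f => e.eval I s - f.eval I s
  | times e f => e.eval I s * f.eval I s
  | quot e f => e.eval I s / f.eval I s

def Test.holds {n m : ℕ} (I : Instance n m) (s : Mem) : Test → Prop
  | nle e f => e.eval s ≤ f.eval s
  | rle e f => e.eval I s ≤ f.eval I s
  | neg b => ¬ b.holds I s
  | conj b c => b.holds I s ∧ c.holds I s

def Mem.setReg (s : Mem) (x k : ℕ) : Mem := { s with reg := Function.update s.reg x k }

def Mem.setArr (s : Mem) (a k e : ℕ) : Mem :=
  { s with arr := Function.update s.arr a (Function.update (s.arr a) k e) }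

/-- `Exec I c s t s'`: on the instance `I`, the program `c` started in memory `s` halts in memory
`s'` after `t` elementary steps. -/
inductive Exec {n m : ℕ} (I : Instance n m) : Prog → Mem → ℕ → Mem → Prop
  | skip {s : Mem} : Exec I .skip s 1 s
  | set {s : Mem} {x : ℕ} {e : NExpr} :
      Exec I (.set x e) s (e.cost + 1) (s.setReg x (e.eval s))
  | put {s : Mem} {a : ℕ} {k e : NExpr} :
      Exec I (.put a k e) s (k.cost + e.cost + 1) (s.setArr a (k.eval s) (e.eval s))
  | seq {c d : Prog} {s s' s'' : Mem} {t t' : ℕ} :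
      Exec I c s t s' → Exec I d s' t' s'' → Exec I (.seq c d) s (t + t') s''
  | iteTrue {b : Test} {c d : Prog} {s s' : Mem} {t : ℕ} :
      b.holds I s → Exec I c s t s' → Exec I (.ite b c d) s (b.cost + t) s'
  | iteFalse {b : Test} {c d : Prog} {s s' : Mem} {t : ℕ} :
      ¬ b.holds I s → Exec I d s t s' → Exec I (.ite b c d) s (b.cost + t) s'
  | loopTrue {b : Test} {c : Prog} {s s' s'' : Mem} {t t' : ℕ} :
      b.holds I s → Exec I c s t s' → Exec I (.loop b c) s' t' s'' →
      Exec I (.loop b c) s (b.cost + t + t') s''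
  | loopFalse {b : Test} {c : Prog} {s : Mem} :
      ¬ b.holds I s → Exec I (.loop b c) s b.cost s

/-- Initial memory: `n` in register `0`, `m` in register `1`, and `0` everywhere else. -/
def Mem.start (n m : ℕ) : Mem where
  reg := fun x => if x = 0 then n else if x = 1 then m else 0
  arr := fun _ _ => 0

/-- The allocation in array `0`: entry `i + 1` at `o` means that agent `i` owns item `o`, and `0`
(or an entry out of range) that item `o` is unassigned. -/
def Mem.alloc (s : Mem) (n m : ℕ) : Alloc n m := fun o =>
  if h : 0 < s.arr 0 o ∧ s.arr 0 o ≤ n then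
    some ⟨s.arr 0 o - 1, lt_of_lt_of_le (Nat.sub_lt h.1 Nat.one_pos) h.2⟩
  else none

end WeightedYankee

namespace WeightedYankee

/-! ## Transfer paths -/

/-! A transfer enlarges the bundle of its first agent by one item and keeps the size of every other
bundle. It creates no new transfer paths: an agent without one values only items of agents who have
none either, and a transfer does not move those items (`TransferPath.unreached`). Removal from the
game is therefore final, and together with the greedy choice this preserves `Balanced`: if `i` has a
transfer path or reaches `k` along `Wants`, then |X_k|/w_k ≤ (|X_i|+1)/w_i. Every iteration but the
last assigns an item, which bounds their number.

Agents value all they hold, so v_i(X_j) ≤ |X_j| = v_j(X_j), and an edge costs at most the difference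
of the levels |X_j|/w_j and |X_i|/w_i. Costs of paths telescope and cycles cost at most 0, so p* is
the least subsidy vector (`isLeast_subsidy`). If every edge of a path from i leads to a bundle with
an item its tail values, the path is a `Wants` chain and costs at most 1/w_i. Otherwise let (a,b) be
its last edge to a worthless bundle: the part up to a costs at most level a − level i, the edge
costs −level a, and the rest at most 1/w_b. Either way ℓ_i ≤ 1/w_min. An agent of highest level
needs no subsidy, which saves the 1 in the total.

The program finds transfer paths by n rounds of relaxation, storing one item per agent, and then
walks along these pointers. -/

theorem card_filter_update {n m : ℕ} (p : Option (Fin n) → Prop) [DecidablePred p]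
    (Y : Alloc n m) (o : Fin m) (a : Option (Fin n)) :
    (Finset.univ.filter (fun x => p (Function.update Y o a x))).card + (if p (Y o) then 1 else 0)
      = (Finset.univ.filter (fun x => p (Y x))).card + (if p a then 1 else 0) := by
  simp only [Finset.card_filter]
  rw [← Finset.add_sum_erase _ _ (Finset.mem_univ o),
    ← Finset.add_sum_erase _ (fun x => if p (Y x) then 1 else 0) (Finset.mem_univ o)]
  have : ∑ x ∈ Finset.univ.erase o, (if p (Function.update Y o a x) then 1 else 0)
      = ∑ x ∈ Finset.univ.erase o, (if p (Y x) then 1 else 0) := by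
    refine Finset.sum_congr rfl fun x hx => ?_
    rw [Function.update_of_ne (Finset.ne_of_mem_erase hx)]
  rw [this, Function.update_self]
  ring

/-- The number of items held by the agents. -/
def Alloc.assigned {n m : ℕ} (X : Alloc n m) : ℕ :=
  (Finset.univ.filter (fun o => (X o).isSome)).card

theorem Alloc.assigned_le {n m : ℕ} (X : Alloc n m) : X.assigned ≤ m :=
  (Finset.card_le_univ _).trans (Fintype.card_fin m).le

theorem Alloc.mem_bundle {n m : ℕ} {X : Alloc n m} {i : Fin n} {o : Fin m} :
    o ∈ X.bundle i ↔ X o = some i := by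
  simp [Alloc.bundle]

namespace Instance

variable {n m : ℕ} {I : Instance n m}

/-- Agent `i` has a transfer path. -/
def HasPath (I : Instance n m) (X : Alloc n m) (i : Fin n) : Prop := ∃ P, I.TransferPath X i P

namespace TransferPath

variable {X : Alloc n m} {i : Fin n} {P : List (Fin n × Fin m)}

theorem head_mem (h : I.TransferPath X i P) : i ∈ P.map Prod.fst := by
  cases h <;> simp

theorem nodup (h : I.TransferPath X i P) : (P.map Prod.fst).Nodup := by
  induction h with
  | last => simp
  | step _ _ hi _ ih => simpa using ⟨by simpa using hi, ih⟩

theorem length_le (h : I.TransferPath X i P) : P.length ≤ n := by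
  simpa using h.nodup.length_le_card

theorem hasPath_of_mem (h : I.TransferPath X i P) {j : Fin n} (hj : j ∈ P.map Prod.fst) :
    I.HasPath X j := by
  induction h with
  | last h1 h2 =>
    simp only [List.map_cons, List.map_nil, List.mem_singleton] at hj
    subst hj
    exact ⟨_, .last h1 h2⟩
  | step h1 h2 h3 h4 ih =>
    rw [List.map_cons, List.mem_cons] at hj
    rcases hj with rfl | hj
    · exact ⟨_, .step h1 h2 h3 h4⟩
    · exact ih hj

theorem owner (h : I.TransferPath X i P) {q : Fin n × Fin m} (hq : q ∈ P) :
    X q.2 = none ∨ ∃ j ∈ P.map Prod.fst, X q.2 = some j := by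
  induction h with
  | last h1 h2 =>
    simp only [List.mem_singleton] at hq
    subst hq
    exact .inl h2
  | step h1 h2 h3 h4 ih =>
    rw [List.mem_cons] at hq
    rcases hq with rfl | hq
    · exact .inr ⟨_, List.mem_cons_of_mem _ h4.head_mem, h2⟩
    · rcases ih hq with h | ⟨j, hj, h⟩
      · exact .inl h
      · exact .inr ⟨j, List.mem_cons_of_mem _ hj, h⟩

/-- Items of the path belong to the dummy agent or to later agents, and the agents are distinct. -/
theorem owner_ne (h : I.TransferPath X i P) {q : Fin n × Fin m} (hq : q ∈ P) :
    X q.2 ≠ some i := by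
  cases h with
  | last h1 h2 =>
    simp only [List.mem_singleton] at hq
    subst hq
    simp [h2]
  | step h1 h2 h3 h4 =>
    intro h
    rw [List.mem_cons] at hq
    rcases hq with rfl | hq
    · have := h2.symm.trans h
      rw [Option.some_inj] at this
      exact h3 (this ▸ h4.head_mem)
    · rcases h4.owner hq with h' | ⟨j, hj, h'⟩
      · simp [h] at h'
      · rw [h, Option.some_inj] at h'
        exact h3 (h' ▸ hj)

theorem pos_of_mem (h : I.TransferPath X i P) {q : Fin n × Fin m} (hq : q ∈ P) :
    0 < I.v q.1 {q.2} := by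
  induction h with
  | last h1 h2 =>
    simp only [List.mem_singleton] at hq
    subst hq
    exact h1
  | step h1 h2 h3 h4 ih =>
    rw [List.mem_cons] at hq
    rcases hq with rfl | hq
    · exact h1
    · exact ih hq

end TransferPath

/-- If `i` already lies on the path of `j`, the part of that path from `i` on serves instead; so
distinctness never obstructs reachability arguments. -/
theorem HasPath.step {X : Alloc n m} {i j : Fin n} {o : Fin m} (hv : 0 < I.v i {o})
    (ho : X o = some j) (hj : I.HasPath X j) : I.HasPath X i := by
  obtain ⟨P, hP⟩ := hj
  by_cases hi : i ∈ P.map Prod.fst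
  · exact hP.hasPath_of_mem hi
  · exact ⟨_, .step hv ho hi hP⟩

theorem transfer_cons (X : Alloc n m) (q : Fin n × Fin m) (P : List (Fin n × Fin m)) :
    transfer X (q :: P) = Function.update (transfer X P) q.2 (some q.1) := rfl

theorem transfer_of_notMem (X : Alloc n m) (P : List (Fin n × Fin m)) {o : Fin m}
    (h : o ∉ P.map Prod.snd) : transfer X P o = X o := by
  induction P with
  | nil => rfl
  | cons q P ih =>
    rw [List.map_cons, List.mem_cons, not_or] at h
    rw [transfer_cons, Function.update_of_ne h.1, ih h.2]

theorem transfer_cases (X : Alloc n m) (P : List (Fin n × Fin m)) (o : Fin m) :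
    (o ∉ P.map Prod.snd ∧ transfer X P o = X o) ∨ ∃ i, (i, o) ∈ P ∧ transfer X P o = some i := by
  induction P with
  | nil => exact .inl ⟨by simp, rfl⟩
  | cons q P ih =>
    rw [transfer_cons]
    by_cases h : o = q.2
    · subst h
      exact .inr ⟨q.1, by simp, by simp⟩
    · rw [Function.update_of_ne h]
      rcases ih with ⟨h1, h2⟩ | ⟨i, h1, h2⟩
      · exact .inl ⟨by rw [List.map_cons, List.mem_cons, not_or]; exact ⟨h, h1⟩, h2⟩
      · exact .inr ⟨i, List.mem_cons_of_mem _ h1, h2⟩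

/-- The transfer along the tail leaves this item with `j`, so prepending a step takes away from `j`
exactly the one item that `j` gained. -/
theorem TransferPath.item_notMem {X : Alloc n m} {j : Fin n} {P : List (Fin n × Fin m)}
    (h : I.TransferPath X j P) {o : Fin m} (ho : X o = some j) : o ∉ P.map Prod.snd := by
  intro hmem
  obtain ⟨q, hq, rfl⟩ := List.mem_map.1 hmem
  exact h.owner_ne hq ho

/-- A statistic of the owners counts, after a transfer, one more item for the first agent of the
path and one less for the dummy agent. -/
theorem TransferPath.card_filter {X : Alloc n m} {u : Fin n} {P : List (Fin n × Fin m)}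
    (h : I.TransferPath X u P) (p : Option (Fin n) → Prop) [DecidablePred p] :
    (Finset.univ.filter (fun x => p (transfer X P x))).card + (if p none then 1 else 0)
      = (Finset.univ.filter (fun x => p (X x))).card + (if p (some u) then 1 else 0) := by
  induction h with
  | @last i o h1 h2 =>
    have := card_filter_update p X o (some i)
    rw [h2] at this
    exact this
  | @step i j o P h1 h2 h3 h4 ih =>
    have := card_filter_update p (transfer X P) o (some i)
    rw [transfer_of_notMem _ _ (h4.item_notMem h2), h2] at this
    rw [transfer_cons]
    dsimp only at this ⊢
    omega

theorem TransferPath.card_bundle {X : Alloc n m} {u : Fin n} {P : List (Fin n × Fin m)}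
    (h : I.TransferPath X u P) (i : Fin n) :
    ((transfer X P).bundle i).card = (X.bundle i).card + if u = i then 1 else 0 := by
  simpa [Alloc.bundle] using h.card_filter (fun a => a = some i)

theorem TransferPath.assigned {X : Alloc n m} {u : Fin n} {P : List (Fin n × Fin m)}
    (h : I.TransferPath X u P) : (transfer X P).assigned = X.assigned + 1 := by
  simpa [Alloc.assigned] using h.card_filter (fun a => a.isSome)

/-- An agent without a transfer path only values items that a transfer does not touch, and that
belong to agents without a transfer path. -/
theorem TransferPath.unreached {X : Alloc n m} {u : Fin n} {P : List (Fin n × Fin m)}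
    (h : I.TransferPath X u P) {i j : Fin n} {o : Fin m} (hi : ¬ I.HasPath X i)
    (hv : 0 < I.v i {o}) (ho : transfer X P o = some j) : X o = some j ∧ ¬ I.HasPath X j := by
  rcases transfer_cases X P o with ⟨h1, h2⟩ | ⟨k, h1, h2⟩
  · rw [h2] at ho
    exact ⟨ho, fun hj => hi (hj.step hv ho)⟩
  · rcases h.owner h1 with h' | ⟨l, hl, h'⟩
    · exact absurd ⟨_, .last hv h'⟩ hi
    · exact absurd ((h.hasPath_of_mem hl).step hv h') hi

/-- An agent without a path before the transfer could start a new one only with an item of another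
such agent, and induction along the new path rules that out. -/
theorem TransferPath.hasPath_anti {X : Alloc n m} {u : Fin n} {P : List (Fin n × Fin m)}
    (h : I.TransferPath X u P) {i : Fin n} (hi : I.HasPath (transfer X P) i) : I.HasPath X i := by
  obtain ⟨Q, hQ⟩ := hi
  induction hQ with
  | last h1 h2 =>
    rcases transfer_cases X P _ with ⟨_, h3⟩ | ⟨k, _, h3⟩
    · exact ⟨_, .last h1 (h3 ▸ h2)⟩
    · simp [h3] at h2
  | step h1 h2 h3 h4 ih =>
    by_contra hi
    exact (h.unreached hi h1 h2).2 ih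

/-- Agent `i` values an item of agent `j`. -/
def Wants (I : Instance n m) (X : Alloc n m) (i j : Fin n) : Prop :=
  ∃ o, 0 < I.v i {o} ∧ X o = some j

/-- A `Wants` chain from an agent without a path stays among such agents, whose wanted items the
transfer did not touch. -/
theorem TransferPath.reach_anti {X : Alloc n m} {u : Fin n} {P : List (Fin n × Fin m)}
    (h : I.TransferPath X u P) {i k : Fin n} (hi : ¬ I.HasPath X i)
    (hr : Relation.ReflTransGen (I.Wants (transfer X P)) i k) :
    Relation.ReflTransGen (I.Wants X) i k ∧ ¬ I.HasPath X k := by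
  induction hr with
  | refl => exact ⟨.refl, hi⟩
  | tail _ hw ih =>
    obtain ⟨o, hv, ho⟩ := hw
    have := h.unreached ih.2 hv ho
    exact ⟨ih.1.tail ⟨o, hv, this.1⟩, this.2⟩

/-! ## Values of bundles -/

/-- Agents only hold items that they value. -/
def Clean (I : Instance n m) (X : Alloc n m) : Prop := ∀ o i, X o = some i → 0 < I.v i {o}

theorem BinaryAdditive.eq_one (hB : I.BinaryAdditive) {i : Fin n} {o : Fin m}
    (h : 0 < I.v i {o}) : I.v i {o} = 1 :=
  ((hB i).2 o).resolve_left h.ne'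

theorem BinaryAdditive.nonneg (hB : I.BinaryAdditive) (i : Fin n) (A : Finset (Fin m)) :
    0 ≤ I.v i A := by
  rw [(hB i).1]
  refine Finset.sum_nonneg fun o _ => ?_
  rcases (hB i).2 o with h | h <;> simp [h]

theorem BinaryAdditive.le_card (hB : I.BinaryAdditive) (i : Fin n) (A : Finset (Fin m)) :
    I.v i A ≤ A.card := by
  rw [(hB i).1]
  calc ∑ o ∈ A, I.v i {o} ≤ ∑ o ∈ A, (1 : ℝ) := by
        refine Finset.sum_le_sum fun o _ => ?_
        rcases (hB i).2 o with h | h <;> simp [h]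
    _ = A.card := by simp

theorem BinaryAdditive.exists_pos (hB : I.BinaryAdditive) {i : Fin n} {A : Finset (Fin m)}
    (h : I.v i A ≠ 0) : ∃ o ∈ A, 0 < I.v i {o} := by
  rw [(hB i).1] at h
  obtain ⟨o, ho, h⟩ := Finset.exists_ne_zero_of_sum_ne_zero h
  exact ⟨o, ho, lt_of_le_of_ne (hB.nonneg _ _) h.symm⟩

theorem Clean.nonRedundant {X : Alloc n m} (hX : I.Clean X) (hB : I.BinaryAdditive) :
    I.NonRedundant X := by
  intro i
  rw [(hB i).1, Finset.sum_congr rfl fun o ho => hB.eq_one (hX o i (Alloc.mem_bundle.1 ho))]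
  simp

theorem TransferPath.clean {X : Alloc n m} {u : Fin n} {P : List (Fin n × Fin m)}
    (h : I.TransferPath X u P) (hX : I.Clean X) : I.Clean (transfer X P) := by
  intro o i ho
  rcases transfer_cases X P o with ⟨_, h2⟩ | ⟨k, h1, h2⟩
  · exact hX o i (h2 ▸ ho)
  · rw [h2, Option.some_inj] at ho
    subst ho
    exact h.pos_of_mem h1

/-! ## Invariants of the executions -/

/-- Per unit of entitlement, an agent who can reach `k`, or who can still obtain an item, would not
fall behind `k` with one more item. -/
def Balanced (I : Instance n m) (X : Alloc n m) : Prop :=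
  ∀ i k, I.HasPath X i ∨ Relation.ReflTransGen (I.Wants X) i k →
    ((X.bundle k).card : ℝ) / I.w k ≤ (((X.bundle i).card : ℝ) + 1) / I.w i

/-- A larger bundle of `i` only helps, so the danger is `k = u`. If `i` had a path, the greedy
choice of `u` covers this case; if not, `i` reaches only agents without a path, hence not `u`. -/
theorem TransferPath.balanced {X : Alloc n m} {u : Fin n} {P : List (Fin n × Fin m)}
    (h : I.TransferPath X u P) (hb : I.Balanced X)
    (hu : ∀ i, I.HasPath X i →
      I.w i / (((X.bundle i).card : ℝ) + 1) ≤ I.w u / (((X.bundle u).card : ℝ) + 1)) :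
    I.Balanced (transfer X P) := by
  intro i k hik
  have hmono : (((X.bundle i).card : ℝ) + 1) / I.w i
      ≤ ((((transfer X P).bundle i).card : ℝ) + 1) / I.w i := by
    have := I.w_pos i
    rw [h.card_bundle i]
    push_cast
    gcongr
    split_ifs <;> simp
  refine le_trans ?_ hmono
  by_cases hi : I.HasPath X i
  · rw [h.card_bundle k]
    split_ifs with huk
    · subst huk
      have hw := I.w_pos i
      have hw' := I.w_pos u
      have := hu i hi
      -- Cross-multiplied, the greedy inequality is exactly the balance of `i` against the enlarged
      -- bundle of `u`.
      rw [div_le_div_iff₀ (by positivity) (by positivity)] at this ⊢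
      push_cast
      linarith
    · simpa using hb i k (.inl hi)
  · rcases hik with hik | hik
    · exact absurd (h.hasPath_anti hik) hi
    · obtain ⟨h1, h2⟩ := h.reach_anti hi hik
      have huk : u ≠ k := fun e => h2 (e ▸ ⟨P, h⟩)
      rw [h.card_bundle k, if_neg huk]
      simpa using hb i k (.inr h1)

/-- What holds in every state of an execution. -/
structure RunInv (I : Instance n m) (t : ℕ) (s : Alloc n m × Set (Fin n)) : Prop where
  clean : I.Clean s.1
  balanced : I.Balanced s.1
  mem_of_hasPath : ∀ i, I.HasPath s.1 i → i ∈ s.2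
  -- While someone is in the game, every past iteration assigned an item; only the closing one does
  -- not, hence the `+ 1` in `le`.
  le_of_nonempty : s.2.Nonempty → t ≤ s.1.assigned
  le : t ≤ s.1.assigned + 1

/-- The set of agents in the game carries no information beyond the allocation, so the program need
not store it. -/
theorem RunInv.remaining_eq {t : ℕ} {s : Alloc n m × Set (Fin n)} (h : I.RunInv t s) :
    I.remaining s.1 s.2 = {i | I.HasPath s.1 i} := by
  ext i
  exact ⟨fun hi => hi.2, fun hi => ⟨h.mem_of_hasPath i hi, hi⟩⟩

theorem Run.inv (hB : I.BinaryAdditive) {t : ℕ} {s : Alloc n m × Set (Fin n)} (h : I.Run t s) :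
    I.RunInv t s := by
  induction h with
  | init =>
    refine ⟨by simp [Clean], fun i k _ => ?_, fun i _ => Set.mem_univ i, fun _ => Nat.zero_le _,
      Nat.zero_le _⟩
    have := I.w_pos i
    simp only [Alloc.bundle]
    simp
    positivity
  | @next t s s' _ hs ih =>
    have hrem := ih.remaining_eq
    cases hs with
    | finish hR he =>
      refine ⟨ih.clean, ih.balanced, fun i hi => ?_, fun h => absurd h (by simp),
        Nat.succ_le_succ (ih.le_of_nonempty hR)⟩
      dsimp only at hrem hi
      rw [← he, hrem]
      exact hi
    | @assign X R u P hR hu hmax hP =>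
      have hle : t + 1 ≤ X.assigned + 1 := Nat.succ_le_succ (ih.le_of_nonempty hR)
      dsimp only at hrem
      rw [← hP.assigned] at hle
      refine ⟨hP.clean ih.clean, hP.balanced ih.balanced fun i hi => ?_, fun i hi => ?_,
        fun _ => hle, hle.trans (Nat.le_succ _)⟩
      · have := hmax i (by rw [hrem]; exact hi)
        rw [gain, gain] at this
        have hnr := ih.clean.nonRedundant hB
        rwa [hnr, hnr] at this
      · dsimp only
        rw [hrem]
        exact hP.hasPath_anti hi

theorem Iteration.exists {X : Alloc n m} {R : Set (Fin n)} (hR : R.Nonempty) :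
    ∃ s', I.Iteration (X, R) s' := by
  rcases (I.remaining X R).eq_empty_or_nonempty with h | h
  · exact ⟨_, .finish hR h⟩
  · obtain ⟨u, hu, hmax⟩ := (I.remaining X R).toFinite.exists_maximalFor (I.gain X) _ h
    obtain ⟨P, hP⟩ := hu.2
    exact ⟨_, .assign hR hu (fun i hi => (le_total _ _).elim id fun h => hmax hi h) hP⟩

/-! ## Subsidies -/

/-- `Y` may be redundant, so the subsidy lemmas do not apply to it directly; but the added items are
worthless to all, and so its values are those of `X`. -/
theorem v_bundle_of_extends (hB : I.BinaryAdditive) {X Y : Alloc n m}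
    (h0 : ∀ o, X o = none → ∀ i, I.v i {o} = 0) (hY : Y.Extends X) (i j : Fin n) :
    I.v i (Y.bundle j) = I.v i (X.bundle j) := by
  rw [(hB i).1, (hB i).1 (X.bundle j)]
  symm
  refine Finset.sum_subset (fun o ho => ?_) fun o ho hn => ?_
  · rw [Alloc.mem_bundle] at ho ⊢
    exact hY o j ho
  · rw [Alloc.mem_bundle] at ho hn
    refine h0 o ?_ i
    rcases h : X o with _ | k
    · rfl
    · have := hY o k h
      rw [ho] at this
      exact absurd (h.trans this.symm) hn

/-- The value of each agent's own bundle per unit of entitlement. -/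
noncomputable def level (I : Instance n m) (X : Alloc n m) (i : Fin n) : ℝ :=
  I.v i (X.bundle i) / I.w i

/-! ### Path costs and levels -/

theorem pathCost_cons_cons (X : Alloc n m) (i j : Fin n) (P : List (Fin n)) :
    I.pathCost X (i :: j :: P) = I.edgeCost X i j + I.pathCost X (j :: P) := rfl

theorem edgeCost_le (hB : I.BinaryAdditive) {X : Alloc n m} (hX : I.NonRedundant X)
    (i j : Fin n) : I.edgeCost X i j ≤ I.level X j - I.level X i := by
  have := I.w_pos j
  rw [edgeCost, level, level, hX j]
  gcongr
  exact hB.le_card _ _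

theorem pathCost_le_of_level_le (hB : I.BinaryAdditive) {X : Alloc n m} (hX : I.NonRedundant X)
    {c : ℝ} (hc : ∀ i, I.level X i ≤ c) (P : List (Fin n)) (i : Fin n) :
    I.pathCost X (i :: P) ≤ c - I.level X i := by
  induction P generalizing i with
  | nil => simpa [pathCost] using hc i
  | cons j P ih =>
    rw [pathCost_cons_cons]
    linarith [ih j, edgeCost_le hB hX i j]

/-- The part of a path before one of its vertices costs at most the difference of the levels. -/
theorem exists_suffix (hB : I.BinaryAdditive) {X : Alloc n m} (hX : I.NonRedundant X)
    {i : Fin n} (P : List (Fin n)) (j : Fin n) (hi : i ∈ j :: P) :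
    ∃ Q, (i :: Q) <:+ (j :: P) ∧
      I.pathCost X (j :: P) ≤ I.level X i - I.level X j + I.pathCost X (i :: Q) := by
  induction P generalizing j with
  | nil =>
    simp only [List.mem_singleton] at hi
    subst hi
    exact ⟨[], List.suffix_rfl, by simp⟩
  | cons k P ih =>
    rw [List.mem_cons] at hi
    rcases hi with rfl | hi
    · exact ⟨k :: P, List.suffix_rfl, by simp⟩
    · obtain ⟨Q, h1, h2⟩ := ih k hi
      refine ⟨Q, h1.trans (List.suffix_cons _ _), ?_⟩
      rw [pathCost_cons_cons]
      linarith [edgeCost_le hB hX j k]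

theorem exists_level_max (hn : 0 < n) (I : Instance n m) (X : Alloc n m) :
    ∃ k, ∀ i, I.level X i ≤ I.level X k :=
  have : Nonempty (Fin n) := ⟨⟨0, hn⟩⟩
  Finite.exists_max _

theorem maxPathCost_le {X : Alloc n m} {i : Fin n} {c : ℝ}
    (h : ∀ P, (i :: P).Nodup → I.pathCost X (i :: P) ≤ c) : I.maxPathCost X i ≤ c := by
  refine csSup_le ⟨0, [i], by simp, by simp, by simp [pathCost]⟩ ?_
  rintro _ ⟨P, hP, hi, rfl⟩
  cases P with
  | nil => simp at hi
  | cons j P =>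
    simp only [List.head?_cons, Option.some_inj] at hi
    subst hi
    exact h P hP

/-- The supremum is meaningful because telescoping bounds all path costs by the distance to the
highest level. -/
theorem le_maxPathCost (hB : I.BinaryAdditive) {X : Alloc n m} (hX : I.NonRedundant X)
    {i : Fin n} {P : List (Fin n)} (hP : (i :: P).Nodup) :
    I.pathCost X (i :: P) ≤ I.maxPathCost X i := by
  refine le_csSup ?_ ⟨_, hP, rfl, rfl⟩
  obtain ⟨k, hk⟩ := I.exists_level_max (Fin.pos i) X
  refine ⟨I.level X k - I.level X i, ?_⟩
  rintro _ ⟨P, hP, hi, rfl⟩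
  cases P with
  | nil => simp at hi
  | cons j P =>
    simp only [List.head?_cons, Option.some_inj] at hi
    subst hi
    exact pathCost_le_of_level_le hB hX hk P j

theorem maxPathCost_nonneg (hB : I.BinaryAdditive) {X : Alloc n m} (hX : I.NonRedundant X)
    (i : Fin n) : 0 ≤ I.maxPathCost X i :=
  le_maxPathCost hB hX (P := []) (by simp)

/-- If a path from `j` passes through `i`, prepending the edge closes a cycle of cost at most 0;
dropping it leaves the suffix from `i`. -/
theorem edgeCost_add_maxPathCost_le (hB : I.BinaryAdditive) {X : Alloc n m}
    (hX : I.NonRedundant X) (i j : Fin n) :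
    I.edgeCost X i j + I.maxPathCost X j ≤ I.maxPathCost X i := by
  rw [← le_sub_iff_add_le']
  refine maxPathCost_le fun P hP => ?_
  rw [le_sub_iff_add_le']
  by_cases hi : i ∈ j :: P
  · obtain ⟨Q, h1, h2⟩ := exists_suffix hB hX P j hi
    linarith [edgeCost_le hB hX i j, le_maxPathCost hB hX (hP.sublist h1.sublist)]
  · exact le_maxPathCost hB hX (P := j :: P) (List.nodup_cons.2 ⟨hi, hP⟩)

theorem wef_iff {X : Alloc n m} {p : Fin n → ℝ} :
    I.WEF X p ↔ ∀ i j, I.edgeCost X i j + p j / I.w j ≤ p i / I.w i := by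
  refine forall₂_congr fun i j => ?_
  rw [edgeCost, add_div, add_div]
  constructor <;> intro h <;> linarith

/-- Divided by the weights, envy-freeness is the triangle inequality for maximum path costs. For
minimality, the inequalities of any admissible `p` are summed along a path, whose last payment is
nonnegative. -/
theorem isLeast_subsidy (hB : I.BinaryAdditive) {X : Alloc n m} (hX : I.NonRedundant X) :
    IsLeast (I.wefSubsidies X) (I.subsidy X) := by
  have hw := I.w_pos
  refine ⟨⟨fun i => mul_nonneg (hw i).le (maxPathCost_nonneg hB hX i), ?_⟩, ?_⟩
  · rw [wef_iff]
    intro i j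
    rw [subsidy, subsidy, mul_div_cancel_left₀ _ (hw i).ne', mul_div_cancel_left₀ _ (hw j).ne']
    exact edgeCost_add_maxPathCost_le hB hX i j
  · rintro p ⟨hp, hwef⟩ i
    rw [wef_iff] at hwef
    rw [subsidy, mul_comm, ← le_div_iff₀ (hw i)]
    refine maxPathCost_le fun P hP => ?_
    induction P generalizing i with
    | nil => exact div_nonneg (hp i) (hw i).le
    | cons j P ih =>
      rw [pathCost_cons_cons]
      linarith [hwef i j, ih j hP.of_cons]

/-! ### Bounds for the subsidies -/

theorem wmin_le (I : Instance n m) (i : Fin n) : I.wmin ≤ I.w i :=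
  ciInf_le (Set.finite_range _).bddBelow i

theorem wmin_pos (hn : 0 < n) (I : Instance n m) : 0 < I.wmin := by
  have : Nonempty (Fin n) := ⟨⟨0, hn⟩⟩
  obtain ⟨i, hi⟩ := exists_eq_ciInf_of_finite (f := I.w)
  rw [wmin, ← hi]
  exact I.w_pos i

theorem level_nonneg (hB : I.BinaryAdditive) (X : Alloc n m) (i : Fin n) : 0 ≤ I.level X i :=
  div_nonneg (hB.nonneg _ _) (I.w_pos i).le

/-- The first case is that of a path whose edges all lead to bundles with valued items; the second
one that of a path with an edge to a worthless bundle. -/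
theorem pathCost_le (hB : I.BinaryAdditive) {X : Alloc n m} (hX : I.NonRedundant X)
    (hb : I.Balanced X) (P : List (Fin n)) (i : Fin n) :
    (∃ k, Relation.ReflTransGen (I.Wants X) i k ∧
      I.pathCost X (i :: P) ≤ I.level X k - I.level X i) ∨
    I.pathCost X (i :: P) ≤ 1 / I.wmin - I.level X i := by
  induction P generalizing i with
  | nil => exact .inl ⟨i, .refl, by simp [pathCost]⟩
  | cons j P ih =>
    have hj := level_nonneg hB X j
    rw [pathCost_cons_cons]
    by_cases h : I.v i (X.bundle j) = 0
    · right
      -- The worthless edge costs minus the level of `i`; what follows climbs from `j` by at most `1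
      -- / w_j` by balance, or is already bounded by the second case.
      have hrest : I.pathCost X (j :: P) ≤ 1 / I.wmin := by
        rcases ih j with ⟨k, hk, h'⟩ | h'
        · have h1 := hb j k (.inr hk)
          have h2 : 1 / I.w j ≤ 1 / I.wmin :=
            one_div_le_one_div_of_le (wmin_pos (Fin.pos i) I) (I.wmin_le j)
          rw [add_div, ← hX k, ← hX j] at h1
          rw [level, level] at h'
          linarith
        · linarith
      rw [edgeCost, h, ← level]
      simp only [zero_div]
      linarith
    · obtain ⟨o, ho, hv⟩ := hB.exists_pos h
      have hij : I.Wants X i j := ⟨o, hv, Alloc.mem_bundle.1 ho⟩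
      have := edgeCost_le hB hX i j
      rcases ih j with ⟨k, hk, h'⟩ | h'
      · exact .inl ⟨k, .head hij hk, by linarith⟩
      · exact .inr (by linarith)

theorem maxPathCost_le_one_div_wmin (hB : I.BinaryAdditive) {X : Alloc n m}
    (hX : I.NonRedundant X) (hb : I.Balanced X) (i : Fin n) :
    I.maxPathCost X i ≤ 1 / I.wmin := by
  refine maxPathCost_le fun P _ => ?_
  rcases pathCost_le hB hX hb P i with ⟨k, hk, h⟩ | h
  · have h1 := hb i k (.inr hk)
    have h2 : 1 / I.w i ≤ 1 / I.wmin :=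
      one_div_le_one_div_of_le (wmin_pos (Fin.pos i) I) (I.wmin_le i)
    rw [add_div, ← hX k, ← hX i] at h1
    rw [level, level] at h
    linarith
  · linarith [level_nonneg hB X i]

theorem subsidy_le (hB : I.BinaryAdditive) {X : Alloc n m} (hX : I.NonRedundant X)
    (hb : I.Balanced X) (i : Fin n) : I.subsidy X i ≤ I.w i / I.wmin := by
  rw [subsidy, ← mul_one_div]
  exact mul_le_mul_of_nonneg_left (maxPathCost_le_one_div_wmin hB hX hb i) (I.w_pos i).le

/-- An agent `k` of highest level has subsidy 0 although its individual bound `w_k / w_min` is at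
least 1. -/
theorem sum_subsidy_le (hn : 0 < n) (hB : I.BinaryAdditive) {X : Alloc n m}
    (hX : I.NonRedundant X) (hb : I.Balanced X) :
    ∑ i, I.subsidy X i ≤ I.W / I.wmin - 1 := by
  obtain ⟨k, hk⟩ := I.exists_level_max hn X
  have hwm := wmin_pos hn I
  have hk0 : I.subsidy X k ≤ 0 := by
    refine mul_nonpos_of_nonneg_of_nonpos (I.w_pos k).le (maxPathCost_le fun P _ => ?_)
    simpa using pathCost_le_of_level_le hB hX hk P k
  rw [W, Finset.sum_div, ← Finset.add_sum_erase _ _ (Finset.mem_univ k),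
    ← Finset.add_sum_erase _ (fun i => I.w i / I.wmin) (Finset.mem_univ k)]
  have h1 : 1 ≤ I.w k / I.wmin := (one_le_div hwm).2 (I.wmin_le k)
  have h2 := Finset.sum_le_sum (s := Finset.univ.erase k) fun i _ => subsidy_le hB hX hb i
  linarith

/-! ### Outputs and their extensions -/

theorem subsidy_congr {X Y : Alloc n m} (h : ∀ i j, I.v i (Y.bundle j) = I.v i (X.bundle j)) :
    I.subsidy Y = I.subsidy X ∧ I.wefSubsidies Y = I.wefSubsidies X := by
  have he : ∀ i j, I.edgeCost Y i j = I.edgeCost X i j := fun i j => by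
    rw [edgeCost, edgeCost, h, h]
  have hp : I.pathCost Y = I.pathCost X := by
    funext P
    induction P with
    | nil => rfl
    | cons i P ih =>
      cases P with
      | nil => rfl
      | cons j P => rw [pathCost_cons_cons, pathCost_cons_cons, he, ih]
  refine ⟨funext fun i => by rw [subsidy, subsidy, maxPathCost, maxPathCost, hp], ?_⟩
  ext p
  simp only [wefSubsidies, WEF, h]

theorem IsOutput.inv (hB : I.BinaryAdditive) {X : Alloc n m} (h : I.IsOutput X) :
    I.Clean X ∧ I.Balanced X ∧ ∀ i, ¬ I.HasPath X i := by
  obtain ⟨t, ht⟩ := h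
  have := ht.inv hB
  exact ⟨this.clean, this.balanced, fun i hi => this.mem_of_hasPath i hi⟩

/-- A valued unassigned item would be a transfer path of length one. -/
theorem Clean.eq_none_iff (hB : I.BinaryAdditive) {X : Alloc n m} (hX : I.Clean X)
    (hp : ∀ i, ¬ I.HasPath X i) (o : Fin m) : X o = none ↔ ∀ i, I.v i {o} = 0 := by
  constructor
  · intro ho i
    by_contra h
    exact hp i ⟨_, .last (lt_of_le_of_ne (hB.nonneg _ _) (Ne.symm h)) ho⟩
  · intro h
    rcases ho : X o with _ | i
    · rfl
    · exact absurd (h i) (hX o i ho).ne'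

end Instance

/-! ## Reasoning about programs -/

section Runs

variable {n m : ℕ} {I : Instance n m} {c d : Prog} {s : Mem} {T T' : ℕ} {Q Q' : Mem → Prop}

/-- Started in `s`, the program halts after at most `T` steps in a memory that satisfies `Q`. -/
def Runs (I : Instance n m) (c : Prog) (s : Mem) (T : ℕ) (Q : Mem → Prop) : Prop :=
  ∃ t s', Exec I c s t s' ∧ t ≤ T ∧ Q s'

theorem Runs.mono (h : Runs I c s T Q) (hT : T ≤ T') (hQ : ∀ s', Q s' → Q' s') :
    Runs I c s T' Q' := by
  obtain ⟨t, s', h1, h2, h3⟩ := h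
  exact ⟨t, s', h1, h2.trans hT, hQ s' h3⟩

theorem Runs.skip (h : Q s) : Runs I .skip s 1 Q := ⟨_, _, .skip, le_rfl, h⟩

theorem Runs.set {x : ℕ} {e : NExpr} (h : Q (s.setReg x (e.eval s))) :
    Runs I (.set x e) s (e.cost + 1) Q := ⟨_, _, .set, le_rfl, h⟩

theorem Runs.put {a : ℕ} {k e : NExpr} (h : Q (s.setArr a (k.eval s) (e.eval s))) :
    Runs I (.put a k e) s (k.cost + e.cost + 1) Q := ⟨_, _, .put, le_rfl, h⟩

theorem Runs.seq (hc : Runs I c s T Q) (hd : ∀ s', Q s' → Runs I d s' T' Q') :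
    Runs I (.seq c d) s (T + T') Q' := by
  obtain ⟨t, s', h1, h2, h3⟩ := hc
  obtain ⟨t', s'', h1', h2', h3'⟩ := hd s' h3
  exact ⟨_, _, .seq h1 h1', add_le_add h2 h2', h3'⟩

theorem Runs.ite {b : Test} (hc : b.holds I s → Runs I c s T Q)
    (hd : ¬ b.holds I s → Runs I d s T' Q) :
    Runs I (.ite b c d) s (b.cost + (T + T')) Q := by
  by_cases h : b.holds I s
  · obtain ⟨t, s', h1, h2, h3⟩ := hc h
    exact ⟨_, _, .iteTrue h h1, by omega, h3⟩
  · obtain ⟨t, s', h1, h2, h3⟩ := hd h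
    exact ⟨_, _, .iteFalse h h1, by omega, h3⟩

/-- A loop with an invariant that carries a bound on the number of remaining rounds. -/
theorem Runs.loop {b : Test} (J : ℕ → Mem → Prop)
    (body : ∀ k s, J k s → b.holds I s → Runs I c s T (fun s' => ∃ k' < k, J k' s'))
    {k : ℕ} (h : J k s) :
    Runs I (.loop b c) s (k * (b.cost + T) + b.cost)
      (fun s' => (∃ k', J k' s') ∧ ¬ b.holds I s') := by
  induction k using Nat.strong_induction_on generalizing s with
  | _ k ih =>
    by_cases hb : b.holds I s
    · obtain ⟨t, s', h1, h2, k', hk, h3⟩ := body k s h hb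
      obtain ⟨t', s'', h1', h2', h3'⟩ := ih k' hk h3
      refine ⟨_, _, .loopTrue hb h1 h1', ?_, h3'⟩
      have := Nat.mul_le_mul_right (b.cost + T) (Nat.succ_le_of_lt hk)
      rw [Nat.succ_mul] at this
      omega
    · exact ⟨_, _, .loopFalse hb, Nat.le_add_left _ _, ⟨k, h⟩, hb⟩

/-- Execute `c` for the values `0, …, N - 1` of register `x`, where `N` is in register `b`. -/
def Prog.forTo (x b : ℕ) (c : Prog) : Prog :=
  .seq (.set x (.const 0)) (.loop (.nle (.plus (.reg x) (.const 1)) (.reg b))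
    (.seq c (.set x (.plus (.reg x) (.const 1)))))

theorem Mem.setReg_self (s : Mem) (x k : ℕ) : (s.setReg x k).reg x = k :=
  Function.update_self _ _ _

theorem Mem.setReg_of_ne (s : Mem) {x y : ℕ} (k : ℕ) (h : y ≠ x) :
    (s.setReg x k).reg y = s.reg y :=
  Function.update_of_ne h _ _

theorem Mem.setReg_arr (s : Mem) (x k : ℕ) : (s.setReg x k).arr = s.arr := rfl

theorem Mem.setArr_self (s : Mem) (a k e : ℕ) :
    (s.setArr a k e).arr a = Function.update (s.arr a) k e :=
  Function.update_self _ _ _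

theorem Mem.setArr_of_ne (s : Mem) {a b : ℕ} (k e : ℕ) (h : b ≠ a) :
    (s.setArr a k e).arr b = s.arr b :=
  Function.update_of_ne h _ _

theorem Mem.setArr_reg (s : Mem) (a k e : ℕ) : (s.setArr a k e).reg = s.reg := rfl

/-- `L` replaces `N` so that all bounds become polynomials in `n + m`. The 9 is the test (5) plus
the increment (4); the 7 is the initialization (2) plus the last test (5). -/
theorem Runs.forTo {x b N L : ℕ} (J : ℕ → Mem → Prop) (hN : N ≤ L)
    (bound : ∀ k s, J k s → s.reg b = N)
    (indep : ∀ k s z, J k s → J k (s.setReg x z))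
    (init : J 0 s)
    (body : ∀ k s, k < N → J k s → s.reg x = k →
      Runs I c s T (fun s' => s'.reg x = k ∧ J (k + 1) s')) :
    Runs I (.forTo x b c) s (L * (T + 9) + 7) (J N) := by
  have hloop : Runs I (.forTo x b c) s (2 + (N * (5 + (T + 4)) + 5)) (J N) := by
    refine Runs.seq (Q := fun s => s.reg x = 0 ∧ J 0 s)
      (Runs.set ⟨Mem.setReg_self _ _ _, indep _ _ _ init⟩) fun s' hs' => ?_
    -- `Runs.loop` counts remaining rounds `r`, so the counter stands at `N - r`.
    refine (Runs.loop (fun r s => r ≤ N ∧ s.reg x = N - r ∧ J (N - r) s) ?_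
      (k := N) ?_).mono le_rfl ?_
    · rintro r s ⟨hr, hx, hJ⟩ hb
      have hlt : s.reg x + 1 ≤ s.reg b := hb
      rw [bound _ _ hJ, hx] at hlt
      refine (body (N - r) s hlt hJ hx).seq fun s'' hs'' => Runs.set ?_
      refine ⟨r - 1, by omega, by omega, ?_, ?_⟩
      · rw [Mem.setReg_self]
        simp only [NExpr.eval, hs''.1]
        omega
      · rw [show N - (r - 1) = N - r + 1 by omega]
        exact indep _ _ _ hs''.2
    · simpa using hs'
    · rintro s'' ⟨⟨r, hr, hx, hJ⟩, hb⟩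
      have hge : ¬ s''.reg x + 1 ≤ s''.reg b := hb
      rw [bound _ _ hJ, hx] at hge
      rwa [show N - r = N by omega] at hJ
  refine hloop.mono ?_ fun _ h => h
  have := Nat.mul_le_mul_right (T + 9) hN
  rw [show 5 + (T + 4) = T + 9 by omega]
  omega

end Runs

/-! ## The program

Registers: `2` is the flag that ends the main loop, `3`, `4` and `5` are counters of rounds,
agents and items, `6` is the chosen agent plus one, and `7`, `8` and `9` serve to walk along a
transfer path. Array `1` holds, for an agent with a known transfer path, her item on it plus one,
and array `2` the sizes of the bundles. -/

namespace Prog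

def reset : Prog := .forTo 4 0 (.put 1 (.reg 4) (.const 0))

/-- Record item `o` (register `5`) for agent `i` (register `4`) if it starts a transfer path. -/
def tryItem : Prog :=
  .ite (.conj (.nle (.get 1 (.reg 4)) (.const 0))
      (.conj (.rle (.ofNat (.const 1)) (.value (.reg 4) (.reg 5)))
        (.neg (.conj (.nle (.const 1) (.get 0 (.reg 5)))
          (.nle (.get 1 (.minus (.get 0 (.reg 5)) (.const 1))) (.const 0))))))
    (.put 1 (.reg 4) (.plus (.reg 5) (.const 1))) .skip

/-- Relaxation in the manner of Bellman and Ford: `n` rounds suffice because the agents of a path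
are distinct. -/
def search : Prog := .forTo 3 0 (.forTo 4 0 (.forTo 5 1 tryItem))

/-- The gain of the agent given by an expression. -/
def gainExpr (e : NExpr) : RExpr := .quot (.weight e) (.ofNat (.plus (.get 2 e) (.const 1)))

def compare : Prog :=
  .ite (.conj (.nle (.const 1) (.get 1 (.reg 4)))
      (.neg (.conj (.nle (.const 1) (.reg 6))
        (.rle (gainExpr (.reg 4)) (gainExpr (.minus (.reg 6) (.const 1)))))))
    (.set 6 (.plus (.reg 4) (.const 1))) .skip

def select : Prog := .seq (.set 6 (.const 0)) (.forTo 4 0 compare)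

/-- The old owner is saved in register `9` before being overwritten, and receives the next item; the
code 0 of the dummy agent ends the walk. -/
def walk : Prog :=
  .loop (.nle (.const 1) (.reg 7))
    (.seq (.set 8 (.minus (.get 1 (.minus (.reg 7) (.const 1))) (.const 1)))
      (.seq (.set 9 (.get 0 (.reg 8)))
        (.seq (.put 0 (.reg 8) (.reg 7)) (.set 7 (.reg 9)))))

def assign : Prog :=
  .seq (.put 2 (.minus (.reg 6) (.const 1))
      (.plus (.get 2 (.minus (.reg 6) (.const 1))) (.const 1)))
    (.seq (.set 7 (.reg 6)) walk)

def iteration : Prog :=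
  .seq reset (.seq search (.seq select
    (.ite (.nle (.const 1) (.reg 6)) assign (.set 2 (.const 1)))))

/-- The weighted General Yankee Swap. -/
def yankee : Prog := .loop (.nle (.reg 2) (.const 0)) iteration

end Prog

/-- The code of an owner in array `0`. -/
def ownerCode {n : ℕ} : Option (Fin n) → ℕ
  | none => 0
  | some i => i + 1

section Correctness

variable {n m : ℕ} {I : Instance n m} {X : Alloc n m} {s : Mem}

/-! ### Correctness of the program -/

theorem alloc_eq (h : ∀ o : Fin m, s.arr 0 o = ownerCode (X o)) : s.alloc n m = X := by
  funext o
  rw [Mem.alloc]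
  rcases ho : X o with _ | i
  · simp [h o, ho, ownerCode]
  · have := i.isLt
    simp [h o, ho, ownerCode, Nat.succ_le_of_lt this]

/-- The memory represents the allocation `X` of the running algorithm. -/
structure Mem.Holds (X : Alloc n m) (s : Mem) : Prop where
  reg0 : s.reg 0 = n
  reg1 : s.reg 1 = m
  reg2 : s.reg 2 = 0
  owner : ∀ o : Fin m, s.arr 0 o = ownerCode (X o)
  count : ∀ i : Fin n, s.arr 2 i = (X.bundle i).card

theorem Mem.Holds.setReg (h : s.Holds X) {x : ℕ} (k : ℕ) (hx : 3 ≤ x) :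
    (s.setReg x k).Holds X where
  reg0 := by rw [Mem.setReg_of_ne _ _ (by omega), h.reg0]
  reg1 := by rw [Mem.setReg_of_ne _ _ (by omega), h.reg1]
  reg2 := by rw [Mem.setReg_of_ne _ _ (by omega), h.reg2]
  owner := h.owner
  count := h.count

theorem Mem.Holds.setArr (h : s.Holds X) (k e : ℕ) : (s.setArr 1 k e).Holds X where
  reg0 := h.reg0
  reg1 := h.reg1
  reg2 := h.reg2
  owner := by rw [Mem.setArr_of_ne _ _ _ (by omega)]; exact h.owner
  count := by rw [Mem.setArr_of_ne _ _ _ (by omega)]; exact h.count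

/-- Following the array `a` from an agent with a nonzero entry yields a transfer path. -/
def Pointers (I : Instance n m) (X : Alloc n m) (a : ℕ → ℕ) : Prop :=
  ∀ i : Fin n, a i ≠ 0 → ∃ P, I.TransferPath X i P ∧ ∀ q ∈ P, a q.1 = q.2 + 1

/-- Item `o` extends the transfer paths found so far to one from `i`. -/
def Enabled (I : Instance n m) (X : Alloc n m) (a : ℕ → ℕ) (i : Fin n) (o : Fin m) : Prop :=
  0 < I.v i {o} ∧ ∀ j : Fin n, X o = some j → a j ≠ 0

/-- Agents on recorded paths have nonzero entries, so these paths avoid `i`: they survive the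
update, and the path of the owner of `o` can be prolonged by `i`. -/
theorem Pointers.update {a : ℕ → ℕ} (h : Pointers I X a) {i : Fin n} {o : Fin m}
    (hi : a i = 0) (he : Enabled I X a i o) :
    Pointers I X (Function.update a i (o + 1)) := by
  have key : ∀ j : Fin n, a j ≠ 0 → ∃ P, I.TransferPath X j P ∧ i ∉ P.map Prod.fst ∧
      ∀ q ∈ P, Function.update a i (o + 1) q.1 = q.2 + 1 := by
    intro j hj
    obtain ⟨P, hP, hq⟩ := h j hj
    have hne : ∀ q ∈ P, q.1 ≠ i := by
      rintro q hqP rfl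
      have := hq q hqP
      omega
    refine ⟨P, hP, fun hiP => ?_, fun q hqP => ?_⟩
    · obtain ⟨q, hqP, rfl⟩ := List.mem_map.1 hiP
      exact hne q hqP rfl
    · rw [Function.update_of_ne (Fin.val_ne_of_ne (hne q hqP)), hq q hqP]
  intro j hj
  by_cases hji : j = i
  · subst hji
    rcases ho : X o with _ | k
    · exact ⟨_, .last he.1 ho, by simp⟩
    · obtain ⟨P, hP, hiP, hq⟩ := key k (he.2 k ho)
      refine ⟨_, .step he.1 ho hiP hP, fun q hqP => ?_⟩
      rw [List.mem_cons] at hqP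
      rcases hqP with rfl | hqP
      · simp
      · exact hq q hqP
  · rw [Function.update_of_ne (Fin.val_ne_of_ne hji)] at hj
    obtain ⟨P, hP, _, hq⟩ := key j hj
    exact ⟨P, hP, hq⟩

theorem runs_tryItem (hB : I.BinaryAdditive) (hs : s.Holds X) (hp : Pointers I X (s.arr 1))
    {i : Fin n} {o : Fin m} (hi : s.reg 4 = i) (ho : s.reg 5 = o) :
    Runs I Prog.tryItem s 40 (fun s' => s'.Holds X ∧ Pointers I X (s'.arr 1) ∧ s'.reg = s.reg ∧
      (∀ j, s.arr 1 j ≠ 0 → s'.arr 1 j ≠ 0) ∧ (Enabled I X (s.arr 1) i o → s'.arr 1 i ≠ 0)) := by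
  -- The guard `1 ≤ s.arr 0 o` matters: for an unassigned item the truncated `0 - 1` would consult
  -- agent 0.
  have hen : Enabled I X (s.arr 1) i o ↔ ((1 : ℝ) ≤ I.v i {o} ∧
      ¬ (1 ≤ s.arr 0 o ∧ s.arr 1 (s.arr 0 o - 1) = 0)) := by
    refine and_congr ⟨fun h => (hB.eq_one h).ge, fun h => one_pos.trans_le h⟩ ?_
    rw [hs.owner o]
    rcases X o with _ | j
    · simp [ownerCode]
    · simp [ownerCode]
  refine Runs.mono (Runs.ite (T := 5) (T' := 1) (fun h => Runs.put ?_) fun h => Runs.skip ?_)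
    (by simp [Test.cost, NExpr.cost, RExpr.cost]) fun _ h => h
  all_goals
    simp only [Test.holds, NExpr.eval, RExpr.eval, hi, ho, Fin.is_lt, dif_pos, Fin.eta,
      Nat.cast_one, Nat.le_zero] at h
    rw [← hen] at h
  · simp only [NExpr.eval, hi, ho]
    rw [Mem.setArr_self]
    refine ⟨hs.setArr _ _, hp.update h.1 h.2, rfl, fun j hj => ?_, fun _ => by simp⟩
    by_cases hji : j = i
    · simp [hji]
    · rwa [Function.update_of_ne hji]
  · exact ⟨hs, hp, rfl, fun j hj => hj, fun he h0 => h ⟨h0, he⟩⟩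

theorem Enabled.mono {a a' : ℕ → ℕ} (haa : ∀ j, a j ≠ 0 → a' j ≠ 0) {i : Fin n} {o : Fin m}
    (h : Enabled I X a i o) : Enabled I X a' i o :=
  ⟨h.1, fun j hj => haa j (h.2 j hj)⟩

theorem runs_items (hB : I.BinaryAdditive) (hs : s.Holds X) (hp : Pointers I X (s.arr 1))
    {i : Fin n} (hi : s.reg 4 = i) :
    Runs I (.forTo 5 1 Prog.tryItem) s ((n + m) * (40 + 9) + 7) (fun s' => s'.Holds X ∧
      Pointers I X (s'.arr 1) ∧ (s'.reg 3 = s.reg 3 ∧ s'.reg 4 = s.reg 4) ∧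
      (∀ j, s.arr 1 j ≠ 0 → s'.arr 1 j ≠ 0) ∧
      ∀ o, Enabled I X (s.arr 1) i o → s'.arr 1 i ≠ 0) := by
  refine (Runs.forTo (N := m) (fun k s' => s'.Holds X ∧ Pointers I X (s'.arr 1) ∧
    (s'.reg 3 = s.reg 3 ∧ s'.reg 4 = s.reg 4) ∧
    (∀ j, s.arr 1 j ≠ 0 → s'.arr 1 j ≠ 0) ∧
    ∀ o : Fin m, o < k → Enabled I X (s.arr 1) i o → s'.arr 1 i ≠ 0) (Nat.le_add_left _ _)
    (fun k s' h => h.1.reg1) ?_ ?_ ?_).mono le_rfl ?_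
  · rintro k s' z ⟨h1, h2, h3, h4⟩
    refine ⟨h1.setReg _ (by omega), h2, ?_, h4⟩
    rwa [Mem.setReg_of_ne _ _ (by omega), Mem.setReg_of_ne _ _ (by omega)]
  · exact ⟨hs, hp, ⟨rfl, rfl⟩, fun _ h => h, fun o ho => absurd ho (Nat.not_lt_zero _)⟩
  · rintro k s' hk ⟨h1, h2, h3, h4, h5⟩ hx
    refine (runs_tryItem (o := ⟨k, hk⟩) hB h1 h2 (h3.2.trans hi) hx).mono le_rfl ?_
    rintro s'' ⟨g1, g2, g3, g4, g5⟩
    rw [g3]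
    refine ⟨hx, g1, g2, h3, fun j hj => g4 j (h4 j hj), fun o ho he => ?_⟩
    rcases Nat.lt_succ_iff_lt_or_eq.1 ho with ho | ho
    · exact g4 i (h5 o ho he)
    · obtain rfl : o = ⟨k, hk⟩ := Fin.ext ho
      exact g5 (he.mono h4)
  · rintro s' ⟨h1, h2, h3, h4, h5⟩
    exact ⟨h1, h2, h3, h4, fun o => h5 o o.isLt⟩

/-- `Enabled` refers to the array at the start of the pass; entries are never erased during it, so
`Enabled.mono` transports this to the moment when the pair is examined. -/
theorem runs_agents (hB : I.BinaryAdditive) (hs : s.Holds X) (hp : Pointers I X (s.arr 1)) :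
    Runs I (.forTo 4 0 (.forTo 5 1 Prog.tryItem)) s
      ((n + m) * ((n + m) * (40 + 9) + 7 + 9) + 7) (fun s' => s'.Holds X ∧
      Pointers I X (s'.arr 1) ∧ s'.reg 3 = s.reg 3 ∧
      ∀ i o, Enabled I X (s.arr 1) i o → s'.arr 1 i ≠ 0) := by
  refine (Runs.forTo (N := n) (fun k s' => s'.Holds X ∧ Pointers I X (s'.arr 1) ∧
    s'.reg 3 = s.reg 3 ∧ (∀ j, s.arr 1 j ≠ 0 → s'.arr 1 j ≠ 0) ∧
    ∀ (i : Fin n) o, i < k → Enabled I X (s.arr 1) i o → s'.arr 1 i ≠ 0) (Nat.le_add_right _ _)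
    (fun k s' h => h.1.reg0) ?_ ?_ ?_).mono le_rfl ?_
  · rintro k s' z ⟨h1, h2, h3, h4⟩
    refine ⟨h1.setReg _ (by omega), h2, ?_, h4⟩
    rwa [Mem.setReg_of_ne _ _ (by omega)]
  · exact ⟨hs, hp, rfl, fun _ h => h, fun i o ho => absurd ho (Nat.not_lt_zero _)⟩
  · rintro k s' hk ⟨h1, h2, h3, h4, h5⟩ hx
    refine (runs_items (i := ⟨k, hk⟩) hB h1 h2 hx).mono le_rfl ?_
    rintro s'' ⟨g1, g2, g3, g4, g5⟩
    refine ⟨g3.2.trans hx, g1, g2, g3.1.trans h3, fun j hj => g4 j (h4 j hj), fun i o hi he => ?_⟩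
    rcases Nat.lt_succ_iff_lt_or_eq.1 hi with hi | hi
    · exact g4 i (h5 i o hi he)
    · obtain rfl : i = ⟨k, hk⟩ := Fin.ext hi
      exact g5 o (he.mono h4)
  · rintro s' ⟨h1, h2, h3, h4, h5⟩
    exact ⟨h1, h2, h3, fun i o => h5 i o i.isLt⟩

/-- After `k` rounds every agent with a path of length at most `k` has an entry, since the tail of
the path was recorded one round earlier. -/
theorem runs_search (hB : I.BinaryAdditive) (hs : s.Holds X) (h0 : ∀ i : Fin n, s.arr 1 i = 0) :
    Runs I Prog.search s
      ((n + m) * ((n + m) * ((n + m) * (40 + 9) + 7 + 9) + 7 + 9) + 7) (fun s' => s'.Holds X ∧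
      Pointers I X (s'.arr 1) ∧ ∀ i : Fin n, I.HasPath X i → s'.arr 1 i ≠ 0) := by
  refine (Runs.forTo (N := n) (fun k s' => s'.Holds X ∧ Pointers I X (s'.arr 1) ∧
    ∀ (i : Fin n) P, I.TransferPath X i P → P.length ≤ k → s'.arr 1 i ≠ 0)
    (Nat.le_add_right _ _) (fun k s' h => h.1.reg0) ?_ ?_ ?_).mono le_rfl ?_
  · rintro k s' z ⟨h1, h2⟩
    exact ⟨h1.setReg _ le_rfl, h2⟩
  · refine ⟨hs, fun i hi => absurd (h0 i) hi, fun i P hP hl => ?_⟩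
    cases hP <;> simp at hl
  · rintro k s' hk ⟨h1, h2, h3⟩ hx
    refine (runs_agents hB h1 h2).mono le_rfl ?_
    rintro s'' ⟨g1, g2, g3, g4⟩
    refine ⟨g3.trans hx, g1, g2, fun i P hP hl => ?_⟩
    cases hP with
    | last hv ho => exact g4 i _ ⟨hv, by simp [ho]⟩
    | step hv ho hi hQ =>
      refine g4 i _ ⟨hv, fun j hj => ?_⟩
      rw [ho, Option.some_inj] at hj
      subst hj
      exact h3 _ _ hQ (by simpa using hl)
  · rintro s' ⟨h1, h2, h3⟩
    exact ⟨h1, h2, fun i ⟨P, hP⟩ => h3 i P hP hP.length_le⟩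

theorem runs_reset (hs : s.Holds X) :
    Runs I Prog.reset s ((n + m) * (3 + 9) + 7)
      (fun s' => s'.Holds X ∧ ∀ i : Fin n, s'.arr 1 i = 0) := by
  refine (Runs.forTo (N := n) (fun k s' => s'.Holds X ∧ ∀ i < k, s'.arr 1 i = 0)
    (Nat.le_add_right _ _) (fun k s' h => h.1.reg0) ?_ ?_ ?_).mono le_rfl ?_
  · rintro k s' z ⟨h1, h2⟩
    exact ⟨h1.setReg _ (by omega), h2⟩
  · exact ⟨hs, fun i hi => absurd hi (Nat.not_lt_zero _)⟩
  · rintro k s' hk ⟨h1, h2⟩ hx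
    refine Runs.put ⟨hx, h1.setArr _ _, fun i hi => ?_⟩
    rw [Mem.setArr_self]
    simp only [NExpr.eval, hx, Function.update_apply]
    split_ifs with hik
    · rfl
    · exact h2 i (by omega)
  · rintro s' ⟨h1, h2⟩
    exact ⟨h1, fun i => h2 i i.isLt⟩

theorem eval_gainExpr (hs : s.Holds X) {e : NExpr} {i : Fin n} (he : e.eval s = i) :
    (Prog.gainExpr e).eval I s = I.w i / (((X.bundle i).card : ℝ) + 1) := by
  simp [Prog.gainExpr, RExpr.eval, NExpr.eval, he, hs.count]

theorem runs_select (hs : s.Holds X) :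
    Runs I Prog.select s (2 + ((n + m) * (40 + 9) + 7))
      (fun s' => s'.Holds X ∧ s'.arr 1 = s.arr 1 ∧
        ((s'.reg 6 = 0 ∧ ∀ i : Fin n, s.arr 1 i = 0) ∨
        ∃ b : Fin n, s'.reg 6 = b + 1 ∧ s.arr 1 b ≠ 0 ∧ ∀ i : Fin n, s.arr 1 i ≠ 0 →
          I.w i / (((X.bundle i).card : ℝ) + 1) ≤ I.w b / (((X.bundle b).card : ℝ) + 1))) := by
  refine Runs.seq (Q := fun s' => s'.Holds X ∧ s'.arr 1 = s.arr 1 ∧ s'.reg 6 = 0)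
    (Runs.set ⟨hs.setReg _ (by omega), rfl, Mem.setReg_self _ _ _⟩) ?_
  rintro s₀ ⟨hs₀, ha, h6⟩
  refine (Runs.forTo (N := n) (fun k s' => s'.Holds X ∧ s'.arr 1 = s.arr 1 ∧
        ((s'.reg 6 = 0 ∧ ∀ i : Fin n, i < k → s.arr 1 i = 0) ∨
        ∃ b : Fin n, s'.reg 6 = b + 1 ∧ s.arr 1 b ≠ 0 ∧ ∀ i : Fin n, i < k → s.arr 1 i ≠ 0 →
          I.w i / (((X.bundle i).card : ℝ) + 1) ≤ I.w b / (((X.bundle b).card : ℝ) + 1)))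
    (Nat.le_add_right _ _) (fun k s' h => h.1.reg0) ?_ ?_ ?_).mono le_rfl ?_
  · rintro k s' z ⟨h1, h2, h3⟩
    refine ⟨h1.setReg _ (by omega), h2, ?_⟩
    rwa [Mem.setReg_of_ne _ _ (by omega)]
  · exact ⟨hs₀, ha, .inl ⟨h6, fun i hi => absurd hi (Nat.not_lt_zero _)⟩⟩
  · rintro k s' hk ⟨h1, h2, h3⟩ hx
    have hgk := eval_gainExpr (I := I) h1 (e := .reg 4) (i := ⟨k, hk⟩) hx
    refine Runs.mono (Runs.ite (T := 4) (T' := 1) (fun h => Runs.set ?_) fun h => Runs.skip ?_)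
      (by simp [Test.cost, NExpr.cost, RExpr.cost, Prog.gainExpr]) fun _ h => h
    all_goals
      simp only [Test.holds, NExpr.eval, hx, hgk, h2, Nat.one_le_iff_ne_zero] at h
    · refine ⟨by rw [Mem.setReg_of_ne _ _ (by omega), hx], h1.setReg _ (by omega), h2,
        .inr ⟨⟨k, hk⟩, ?_, h.1, fun i hi hi0 => ?_⟩⟩
      · rw [Mem.setReg_self]
        simp [NExpr.eval, hx]
      · rcases Nat.lt_succ_iff_lt_or_eq.1 hi with hi | hi
        · rcases h3 with ⟨_, h3⟩ | ⟨b, hb, hb0, hmax⟩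
          · exact absurd (h3 i hi) hi0
          -- The incumbent is replaced only by an agent of strictly larger gain.
          · refine (hmax i hi hi0).trans (le_of_lt (not_le.1 fun hle => h.2 ⟨by omega, ?_⟩))
            rwa [eval_gainExpr h1 (i := b) (by simp [NExpr.eval, hb])]
        · obtain rfl : i = ⟨k, hk⟩ := Fin.ext hi
          exact le_rfl
    · refine ⟨hx, h1, h2, ?_⟩
      rcases h3 with ⟨h60, h3⟩ | ⟨b, hb, hb0, hmax⟩
      · refine .inl ⟨h60, fun i hi => ?_⟩
        rcases Nat.lt_succ_iff_lt_or_eq.1 hi with hi | hi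
        · exact h3 i hi
        · by_contra hi0
          exact h ⟨hi ▸ hi0, fun hh => hh.1 h60⟩
      · refine .inr ⟨b, hb, hb0, fun i hi hi0 => ?_⟩
        rcases Nat.lt_succ_iff_lt_or_eq.1 hi with hi | hi
        · exact hmax i hi hi0
        · obtain rfl : i = ⟨k, hk⟩ := Fin.ext hi
          by_contra hlt
          refine h ⟨hi0, fun hh => hlt ?_⟩
          rw [← eval_gainExpr h1 (e := .minus (.reg 6) (.const 1)) (i := b)
            (by simp [NExpr.eval, hb])]
          exact hh.2
  · rintro s' ⟨h1, h2, h3⟩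
    refine ⟨h1, h2, ?_⟩
    rcases h3 with ⟨h60, h3⟩ | ⟨b, hb, hb0, hmax⟩
    · exact .inl ⟨h60, fun i => h3 i i.isLt⟩
    · exact .inr ⟨b, hb, hb0, fun i => hmax i i.isLt⟩

/-! ### Walking along the transfer path -/

/-- The walk updates the head of the path first, whereas `transfer` updates it last; the updates
commute since the items differ. -/
theorem transfer_update (Z : Alloc n m) (P : List (Fin n × Fin m)) {o : Fin m}
    (a : Option (Fin n)) (h : o ∉ P.map Prod.snd) :
    Instance.transfer (Function.update Z o a) P
      = Function.update (Instance.transfer Z P) o a := by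
  induction P with
  | nil => rfl
  | cons q P ih =>
    rw [List.map_cons, List.mem_cons, not_or] at h
    rw [Instance.transfer_cons, Instance.transfer_cons, ih h.2, Function.update_comm h.1]

/-- Stated with the remaining walk as a hypothesis, so that steps chain by induction on the path.
The 18 is the test (3) plus the body (15). -/
theorem runs_walk_step {i : Fin n} {o : Fin m} {Z : Alloc n m} (h7 : s.reg 7 = i + 1)
    (hp : s.arr 1 i = o + 1) (hZ : ∀ o : Fin m, s.arr 0 o = ownerCode (Z o)) {T : ℕ}
    {Q : Mem → Prop}
    (h : ∀ s', s'.reg 7 = ownerCode (Z o) → s'.arr 1 = s.arr 1 → s'.arr 2 = s.arr 2 →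
      (∀ x < 3, s'.reg x = s.reg x) →
      (∀ o' : Fin m, s'.arr 0 o' = ownerCode (Function.update Z o (some i) o')) →
      Runs I Prog.walk s' T Q) :
    Runs I Prog.walk s (T + 18) Q := by
  have hbody : Runs I (.seq (.set 8 (.minus (.get 1 (.minus (.reg 7) (.const 1))) (.const 1)))
      (.seq (.set 9 (.get 0 (.reg 8)))
        (.seq (.put 0 (.reg 8) (.reg 7)) (.set 7 (.reg 9))))) s (7 + (3 + (3 + 2)))
      (fun s' => s'.reg 7 = ownerCode (Z o) ∧ s'.arr 1 = s.arr 1 ∧ s'.arr 2 = s.arr 2 ∧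
      (∀ x < 3, s'.reg x = s.reg x) ∧
      (∀ o' : Fin m, s'.arr 0 o' = ownerCode (Function.update Z o (some i) o'))) := by
    refine Runs.seq (Q := fun s' => s' = s.setReg 8 o) (Runs.set ?_) ?_
    · simp [NExpr.eval, h7, hp]
    rintro _ rfl
    refine Runs.seq (Q := fun s' => s' = (s.setReg 8 o).setReg 9 (ownerCode (Z o)))
      (Runs.set ?_) ?_
    · simp [NExpr.eval, Mem.setReg_self, Mem.setReg_arr, hZ]
    rintro _ rfl
    refine Runs.seq
      (Q := fun s' => s' = ((s.setReg 8 o).setReg 9 (ownerCode (Z o))).setArr 0 o (i + 1))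
      (Runs.put ?_) ?_
    · simp [NExpr.eval, Mem.setReg, h7]
    rintro _ rfl
    refine Runs.set ⟨?_, rfl, rfl, fun x hx => ?_, fun o' => ?_⟩
    · simp [NExpr.eval, Mem.setReg, Mem.setArr]
    · rw [Mem.setReg_of_ne _ _ (by omega), Mem.setArr_reg, Mem.setReg_of_ne _ _ (by omega),
        Mem.setReg_of_ne _ _ (by omega)]
    · rw [Mem.setReg_arr, Mem.setArr_self, Mem.setReg_arr, Mem.setReg_arr]
      by_cases ho : o' = o
      · subst ho
        simp [ownerCode]
      · rw [Function.update_of_ne ho, Function.update_of_ne (Fin.val_ne_of_ne ho), hZ]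
  obtain ⟨t, s', h1, h2, g1, g2, g3, g4, g5⟩ := hbody
  obtain ⟨t', s'', h1', h2', h3'⟩ := h s' g1 g2 g3 g4 g5
  refine ⟨_, _, .loopTrue ?_ h1 h1', ?_, h3'⟩
  · simp [Test.holds, NExpr.eval, h7]
  · simp only [Test.cost, NExpr.cost]
    omega

theorem runs_walk_end (h7 : s.reg 7 = 0) {Q : Mem → Prop} (hQ : Q s) :
    Runs I Prog.walk s 3 Q :=
  ⟨_, _, .loopFalse (by simp [Test.holds, NExpr.eval, h7]), le_rfl, hQ⟩

/-- `Z` is the partly updated allocation; the induction only needs it to agree with `X` on the items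
still ahead. -/
theorem runs_walk {i : Fin n} {P : List (Fin n × Fin m)} (hP : I.TransferPath X i P)
    (Z : Alloc n m) (hXZ : ∀ q ∈ P, Z q.2 = X q.2) (h7 : s.reg 7 = i + 1)
    (hp : ∀ q ∈ P, s.arr 1 q.1 = q.2 + 1) (hZ : ∀ o : Fin m, s.arr 0 o = ownerCode (Z o)) :
    Runs I Prog.walk s (P.length * 18 + 3) (fun s' => (∀ x < 3, s'.reg x = s.reg x) ∧
      s'.arr 2 = s.arr 2 ∧
      ∀ o : Fin m, s'.arr 0 o = ownerCode (Instance.transfer Z P o)) := by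
  induction hP generalizing s Z with
  | last hv ho =>
    refine (runs_walk_step h7 (hp _ (List.mem_singleton_self _)) hZ (T := 3)
      fun s' g1 g2 g3 g4 g5 => runs_walk_end ?_ ?_).mono (by simp) fun _ h => h
    · rw [g1, hXZ _ (List.mem_singleton_self _)]
      simp only [ho]
      rfl
    · exact ⟨g4, g3, g5⟩
  | @step i j o P hv ho hi hP ih =>
    have hne := hP.item_notMem ho
    refine (runs_walk_step h7 (hp _ List.mem_cons_self) hZ (T := P.length * 18 + 3)
      fun s' g1 g2 g3 g4 g5 => ?_).mono (by simp only [List.length_cons]; omega) fun _ h => h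
    refine (ih (Function.update Z o (some i)) (fun q hq => ?_) ?_ (fun q hq => ?_) g5).mono
      le_rfl ?_
    · rw [Function.update_of_ne fun h : q.2 = o => hne (h ▸ List.mem_map_of_mem hq)]
      exact hXZ q (List.mem_cons_of_mem _ hq)
    · rw [g1, hXZ _ List.mem_cons_self]
      simp only [ho]
      rfl
    · rw [g2]
      exact hp q (List.mem_cons_of_mem _ hq)
    · rintro s'' ⟨k1, k2, k3⟩
      refine ⟨fun x hx => (k1 x hx).trans (g4 x hx), k2.trans g3, fun o' => ?_⟩
      rw [k3, transfer_update _ _ _ hne]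
      rfl

theorem runs_assign (hs : s.Holds X) {u : Fin n} {P : List (Fin n × Fin m)}
    (hP : I.TransferPath X u P) (hp : ∀ q ∈ P, s.arr 1 q.1 = q.2 + 1) (h6 : s.reg 6 = u + 1) :
    Runs I Prog.assign s (10 + (2 + ((n + m) * 18 + 3)))
      (fun s' => s'.Holds (Instance.transfer X P)) := by
  refine Runs.seq (Q := fun s' => s' = s.setArr 2 u ((X.bundle u).card + 1)) (Runs.put ?_) ?_
  · simp [NExpr.eval, h6, hs.count]
  rintro _ rfl
  refine Runs.seq
    (Q := fun s' => s' = (s.setArr 2 u ((X.bundle u).card + 1)).setReg 7 (u + 1)) (Runs.set ?_) ?_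
  · simp [NExpr.eval, Mem.setArr_reg, h6]
  rintro _ rfl
  refine (runs_walk (s := (s.setArr 2 u ((X.bundle u).card + 1)).setReg 7 (u + 1)) hP X
    (fun _ _ => rfl) (Mem.setReg_self _ _ _) hp hs.owner).mono ?_ ?_
  · have := hP.length_le
    omega
  · rintro s' ⟨h1, h2, h3⟩
    refine ⟨?_, ?_, ?_, h3, fun i => ?_⟩
    · rw [h1 0 (by omega), Mem.setReg_of_ne _ _ (by omega), Mem.setArr_reg, hs.reg0]
    · rw [h1 1 (by omega), Mem.setReg_of_ne _ _ (by omega), Mem.setArr_reg, hs.reg1]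
    · rw [h1 2 (by omega), Mem.setReg_of_ne _ _ (by omega), Mem.setArr_reg, hs.reg2]
    · rw [h2, Mem.setReg_arr, Mem.setArr_self, hP.card_bundle]
      by_cases hiu : i = u
      · subst hiu
        simp
      · rw [Function.update_of_ne (Fin.val_ne_of_ne hiu), if_neg (Ne.symm hiu), hs.count]
        rfl

/-- A bound for the number of steps of one iteration. -/
def iterationCost (L : ℕ) : ℕ :=
  (L * (3 + 9) + 7) + ((L * (L * (L * (40 + 9) + 7 + 9) + 7 + 9) + 7) +
    ((2 + (L * (40 + 9) + 7)) + (3 + ((10 + (2 + (L * 18 + 3))) + 2))))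

/-- The search marks exactly the agents with a transfer path, which are the remaining ones; an empty
selection is thus the closing iteration. -/
theorem runs_iteration (hB : I.BinaryAdditive) (hs : s.Holds X) {t : ℕ} {R : Set (Fin n)}
    (hrun : I.Run t (X, R)) (hR : R.Nonempty) :
    Runs I Prog.iteration s (iterationCost (n + m)) (fun s' =>
      (∃ X' R', I.Run (t + 1) (X', R') ∧ R'.Nonempty ∧ s'.Holds X') ∨
      s'.reg 2 = 1 ∧ I.IsOutput (s'.alloc n m)) := by
  have hrem : I.remaining X R = {i | I.HasPath X i} := (hrun.inv hB).remaining_eq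
  refine (runs_reset hs).seq fun s₁ h₁ => (runs_search hB h₁.1 h₁.2).seq ?_
  rintro s₂ ⟨hs₂, hp, hc⟩
  refine (runs_select (I := I) hs₂).seq ?_
  rintro s₃ ⟨hs₃, ha, h6⟩
  refine Runs.ite (fun h => ?_) fun h => Runs.set ?_
  · rcases h6 with ⟨h6, _⟩ | ⟨u, h6, hu0, hmax⟩
    · simp [Test.holds, NExpr.eval, h6] at h
    · obtain ⟨P, hP, hq⟩ := hp u hu0
      refine (runs_assign hs₃ hP (by rwa [ha]) h6).mono le_rfl fun s' hs' => .inl ?_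
      have hu : u ∈ I.remaining X R := by rw [hrem]; exact ⟨P, hP⟩
      refine ⟨_, _, .next hrun (.assign hR hu (fun i hi => ?_) hP), ⟨u, hu⟩, hs'⟩
      have hnr := (hrun.inv hB).clean.nonRedundant hB
      rw [Instance.gain, Instance.gain, hnr, hnr]
      rw [hrem] at hi
      exact hmax i (hc i hi)
  · rcases h6 with ⟨_, h0⟩ | ⟨u, h6, _⟩
    · refine .inr ⟨Mem.setReg_self _ _ _, t + 1, ?_⟩
      rw [alloc_eq (s := s₃.setReg _ _) (X := X) hs₃.owner]
      refine .next hrun (.finish hR ?_)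
      rw [hrem, Set.eq_empty_iff_forall_notMem]
      exact fun i hi => hc i hi (h0 i)
    · simp [Test.holds, NExpr.eval, h6] at h

theorem holds_start : (Mem.start n m).Holds (fun _ => none : Alloc n m) where
  reg0 := rfl
  reg1 := rfl
  reg2 := rfl
  owner := fun _ => rfl
  count := fun _ => by simp [Mem.start, Alloc.bundle]

theorem runs_yankee (hn : 0 < n) (hB : I.BinaryAdditive) :
    Runs I Prog.yankee (Mem.start n m) ((n + m + 2) * (3 + iterationCost (n + m)) + 3)
      (fun s' => I.IsOutput (s'.alloc n m)) := by
  -- Runs satisfy `t ≤ m + 1`, so starting the measure at `m + 2` keeps it positive before every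
  -- iteration.
  refine (Runs.loop (k := m + 2) (T := iterationCost (n + m)) (fun k s =>
    (∃ t X R, t + k = m + 2 ∧ I.Run t (X, R) ∧ R.Nonempty ∧ s.Holds X) ∨
      s.reg 2 = 1 ∧ I.IsOutput (s.alloc n m)) ?_
    (.inl ⟨0, _, _, by omega, .init, ⟨⟨0, hn⟩, Set.mem_univ _⟩, holds_start⟩)).mono ?_ ?_
  · rintro k s (⟨t, X, R, hk, hrun, hR, hs⟩ | ⟨h2, _⟩) hb
    · have ht := (hrun.inv hB).le
      have hX := X.assigned_le
      dsimp only at ht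
      refine (runs_iteration hB hs hrun hR).mono le_rfl ?_
      rintro s' (⟨X', R', h⟩ | h)
      · exact ⟨k - 1, by omega, .inl ⟨t + 1, X', R', by omega, h⟩⟩
      · exact ⟨k - 1, by omega, .inr h⟩
    · simp [Test.holds, NExpr.eval, h2] at hb
  · exact Nat.add_le_add_right (Nat.mul_le_mul_right _ (by omega)) _
  · rintro s' ⟨⟨k, ⟨t, X, R, hk, hrun, hR, hs⟩ | h⟩, hb⟩
    · simp [Test.holds, NExpr.eval, hs.reg2] at hb
    · exact h.2

open Polynomial in
theorem exists_polynomial : ∃ p : Polynomial ℕ, ∀ L,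
    p.eval L = (L + 2) * (3 + iterationCost L) + 3 := by
  refine ⟨(X + 2) * (3 + ((X * (3 + 9) + 7) +
    ((X * (X * (X * (40 + 9) + 7 + 9) + 7 + 9) + 7) +
    ((2 + (X * (40 + 9) + 7)) + (3 + ((10 + (2 + (X * 18 + 3))) + 2)))))) + 3, fun L => ?_⟩
  simp [iterationCost]

end Correctness
end WeightedYankee

/-! ### The theorem -/

theorem mainTheorem8 :
    -- every execution, whatever the tie-breaking and the transfer paths
    (∀ (n m : ℕ) (I : WeightedYankee.Instance n m), 0 < n → I.BinaryAdditive →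
      -- stops after at most `m + n` iterations, and is never stuck before
      (∀ t s, I.Run t s → t ≤ m + n) ∧
      (∀ t s, I.Run t s → s.2.Nonempty → ∃ s', I.Iteration s s') ∧
      -- and the output has the stated properties
      (∀ X : WeightedYankee.Alloc n m, I.IsOutput X →
        I.NonRedundant X ∧
        (∀ o, X o = none ↔ ∀ i, I.v i {o} = 0) ∧
        -- for `X` itself and for any distribution of the worthless unassigned items
        ∀ Y : WeightedYankee.Alloc n m, Y.Extends X →
          I.WEFable Y ∧
          IsLeast (I.wefSubsidies Y) (I.subsidy Y) ∧
          (∀ i, I.subsidy Y i ≤ I.w i / I.wmin) ∧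
          ∑ i, I.subsidy Y i ≤ I.W / I.wmin - 1)) ∧
    -- one program carries out the algorithm on all instances in polynomial time
    (∃ (c : WeightedYankee.Prog) (p : Polynomial ℕ),
      ∀ (n m : ℕ) (I : WeightedYankee.Instance n m), 0 < n → I.BinaryAdditive →
        ∃ (t : ℕ) (s : WeightedYankee.Mem),
          WeightedYankee.Exec I c (WeightedYankee.Mem.start n m) t s ∧
          t ≤ p.eval (n + m) ∧
          I.IsOutput (s.alloc n m)) := by
  refine ⟨fun n m I hn hB => ⟨fun t s h => ?_, fun t s _ hs => ?_, fun X hX => ?_⟩, ?_⟩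
  -- At most one iteration assigns nothing, so `t ≤ m + 1 ≤ m + n`.
  · have := (h.inv hB).le
    have := s.1.assigned_le
    omega
  · exact WeightedYankee.Instance.Iteration.exists hs
  · obtain ⟨hc, hb, hp⟩ := hX.inv hB
    have hnr := hc.nonRedundant hB
    have h0 := hc.eq_none_iff hB hp
    refine ⟨hnr, h0, fun Y hY => ?_⟩
    obtain ⟨hs, hw⟩ := WeightedYankee.Instance.subsidy_congr
      (WeightedYankee.Instance.v_bundle_of_extends hB (fun o => (h0 o).1) hY)
    have hl : IsLeast (I.wefSubsidies Y) (I.subsidy Y) := by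
      rw [hs, hw]
      exact WeightedYankee.Instance.isLeast_subsidy hB hnr
    refine ⟨⟨_, hl.1⟩, hl, ?_⟩
    rw [hs]
    exact ⟨WeightedYankee.Instance.subsidy_le hB hnr hb,
      WeightedYankee.Instance.sum_subsidy_le hn hB hnr hb⟩
  · obtain ⟨p, hp⟩ := WeightedYankee.exists_polynomial
    refine ⟨WeightedYankee.Prog.yankee, p, fun n m I hn hB => ?_⟩
    rw [hp]
    exact WeightedYankee.runs_yankee hn hB
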